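/- Identify $\mathbb R^2$ with $\mathbb C$, let $J$ be the rotation by $+\pi/2$, and let $\angle(v,w)$ be the oriented angle from $v$ to $w$. For a regular curve $\gamma:[a,b]\to\mathbb R^2$ put $\tau=\partial_p\gamma/|\partial_p\gamma|$, $\nu=J\tau$, $ds=|\partial_p\gamma|\,dp$, $\kappa=\langle\partial_p^2\gamma,\nu\rangle/|\partial_p\gamma|^2$, $L(\gamma)=\int_a^b ds$ and $\bar\kappa=\frac1{L(\gamma)}\int_a^b\kappa\,ds$. Let $\Sigma\subset\mathbb R^2$ be a support curve, i.e. the image of a smooth, convex, simple, smoothly closed curve, parametrized by arclength and positively oriented, and let ${}^\Sigma\vec\tau:\Sigma\to\mathbb S^1$ be its unit tangent. The outer domain created by $\Sigma$ is the unbounded component of $\mathbb R^2\setminus\Sigma$. Put $${}^\Sigma d:=\min\{|x-y| : x,y\in\Sigma,\ {}^\Sigma\vec\tau(x)=-{}^\Sigma\vec\tau(y)\}.$$ Let $c_0:[a,b]\to\mathbb R^2$ ($a<b$) be an initial curve, i.e. a smooth regular curve with $c_0(a),c_0(b)\in\Sigma$, $\angle(\tau_0(a),{}^\Sigma\vec\tau(c_0(a)))=\frac\pi2$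 and $\angle(\tau_0(b),{}^\Sigma\vec\tau(c_0(b)))=-\frac\pi2$. Let $0<T\le\infty$, and let $c:[a,b]\times[0,T)\to\mathbb R^2$ be a solution of the area preserving curve shortening problem with Neumann free boundary conditions, i.e. a family of regular curves $c_t=c(\cdot,t)$, of class $C^{2,1}$ (twice continuously differentiable in $p$, once in $t$) on $[a,b]\times[0,T)$ and $C^\infty$ on $[a,b]\times(0,T)$, such that $$\partial_t c(p,t)=(\kappa(p,t)-\bar\kappa(t))\,\nu(p,t)\quad\text{for }(p,t)\in[a,b]\times[0,T),\qquad c(\cdot,0)=c_0,$$ and, for all $t\in[0,T)$, $c(a,t),c(b,t)\in\Sigma$, $\angle(\tau(a,t),{}^\Sigma\vec\tau(c(a,t)))=\frac\pi2$ and $\angle(\tau(b,t),{}^\Sigma\vec\tau(c(b,t)))=-\frac\pi2$. Theorem. Assume that the curvature $\kappa_0$ of $c_0$ is positive on $[a,b]$, that $c_0$ has no self-intersection (it is injective on $[a,b]$), that $c_0$ is contained, except for its end points on $\Sigma$, in the outer domain created by $\Sigma$, and that $L(c_0)<{}^\Sigma d$. Then $$\int_a^b\kappa(p,t)\,ds<2\pi\qquad\text{for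 all }t\in[0,T).$$ -/

import Mathlib

open scoped ContDiff

noncomputable section

/-! The Euclidean plane is `ℂ`, with its real inner product and its standard orientation, so that
the rotation `J` by `+π/2` is multiplication by `Complex.I`.

## Regular curves defined on a compact interval

Derivatives of a curve `γ : [a, b] → ℂ` are derivatives within `Set.Icc a b` (one-sided at the two
end points); values of `γ` outside of `[a, b]` never matter. -/

/-- `∂_p γ`, for a curve `γ` on `[a, b]`. -/
def velocity (a b : ℝ) (γ : ℝ → ℂ) (p : ℝ) : ℂ :=
  derivWithin γ (Set.Icc a b) p

/-- `∂_p² γ`. -/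
def acceleration (a b : ℝ) (γ : ℝ → ℂ) (p : ℝ) : ℂ :=
  derivWithin (velocity a b γ) (Set.Icc a b) p

/-- The unit tangent `τ = ∂_p γ / |∂_p γ|`. -/
def unitTangent (a b : ℝ) (γ : ℝ → ℂ) (p : ℝ) : ℂ :=
  ‖velocity a b γ p‖⁻¹ • velocity a b γ p

/-- The unit normal `ν = J τ`. -/
def unitNormal (a b : ℝ) (γ : ℝ → ℂ) (p : ℝ) : ℂ :=
  Complex.I * unitTangent a b γ p

/-- The curvature `κ = ⟨∂_p² γ, ν⟩ / |∂_p γ|²`. -/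
def curvature (a b : ℝ) (γ : ℝ → ℂ) (p : ℝ) : ℝ :=
  inner ℝ (acceleration a b γ p) (unitNormal a b γ p) / ‖velocity a b γ p‖ ^ 2

/-- The length `L = ∫ ds`, where `ds = |∂_p γ| dp`. -/
def curveLength (a b : ℝ) (γ : ℝ → ℂ) : ℝ :=
  ∫ p in a..b, ‖velocity a b γ p‖

/-- The total curvature `∫ κ ds`. -/
def totalCurvature (a b : ℝ) (γ : ℝ → ℂ) : ℝ :=
  ∫ p in a..b, curvature a b γ p * ‖velocity a b γ p‖

/-- The average of the curvature, `∫ κ ds / ∫ ds`. -/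
def averageCurvature (a b : ℝ) (γ : ℝ → ℂ) : ℝ :=
  totalCurvature a b γ / curveLength a b γ

/-! ## The support curve -/

/-- `f : ℝ → ℂ` is (the periodic extension, of period `ℓ`, of) a support curve: a smooth, convex,
simple, smoothly closed curve, parametrized by arclength and positively oriented. -/
structure IsSupportCurve (f : ℝ → ℂ) (ℓ : ℝ) : Prop where
  period_pos : 0 < ℓ
  periodic : Function.Periodic f ℓ
  smooth : ContDiff ℝ ∞ f
  arclength : ∀ s, ‖deriv f s‖ = 1
  simple : Set.InjOn f (Set.Ico 0 ℓ)
  /-- Convexity and positive orientation: the curve stays on one side of each of its tangent lines,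
  namely on the left one, into which the normal `J f'` points. -/
  convex : ∀ s u, 0 ≤ inner ℝ (f u - f s) (Complex.I * deriv f s)

/-- The outer domain created by the closed curve with image `S`: the points of the complement of
`S` whose connected component in the complement is unbounded. -/
def outerDomain (S : Set ℂ) : Set ℂ :=
  {x | x ∈ Sᶜ ∧ ¬ Bornology.IsBounded (connectedComponentIn Sᶜ x)}

/-- The minimum of `|x - y|` over all points `x = f s`, `y = f u` of the support curve that have
opposite unit tangents. (The set is nonempty and compact, so the infimum is a minimum.) -/
def oppositeTangentDist (f : ℝ → ℂ) : ℝ :=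
  sInf {d | ∃ s u, deriv f s = -deriv f u ∧ d = ‖f s - f u‖}

attribute [local instance] Complex.finrank_real_complex_fact

/-- The point `x` lies on the support curve `f`, and the oriented angle from the vector `v` to the
unit tangent of the support curve at `x` is `θ`. -/
def MeetsAtAngle (f : ℝ → ℂ) (x v : ℂ) (θ : ℝ) : Prop :=
  ∃ s, f s = x ∧ Complex.orientation.oangle v (deriv f s) = (θ : Real.Angle)

/-! ## Initial curves and solutions -/

/-- `c₀ : [a, b] → ℂ` is an initial curve for the support curve `f`. -/
structure IsInitialCurve (f : ℝ → ℂ) (a b : ℝ) (c₀ : ℝ → ℂ) : Prop where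
  lt : a < b
  smooth : ContDiffOn ℝ ∞ c₀ (Set.Icc a b)
  regular : ∀ p ∈ Set.Icc a b, velocity a b c₀ p ≠ 0
  left : MeetsAtAngle f (c₀ a) (unitTangent a b c₀ a) (Real.pi / 2)
  right : MeetsAtAngle f (c₀ b) (unitTangent a b c₀ b) (-(Real.pi / 2))

/-- The time interval `[0, T)`, where `T = ⊤` is allowed. -/
def timeInterval (T : EReal) : Set ℝ :=
  {t | 0 ≤ t ∧ (t : EReal) < T}

/-- `c : [a, b] × [0, T) → ℂ` is a solution of the area preserving curve shortening problem with
Neumann free boundary conditions, with support curve `f` and initial curve `c₀`. It is of class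
`C^{2,1}` on `[a, b] × [0, T)` (two derivatives in space, one in time) and smooth on
`[a, b] × (0, T)`. -/
structure IsSolution (f : ℝ → ℂ) (a b : ℝ) (c₀ : ℝ → ℂ) (T : EReal) (c : ℝ → ℝ → ℂ) : Prop where
  contDiffOn_space : ∀ t ∈ timeInterval T, ContDiffOn ℝ 2 (fun p => c p t) (Set.Icc a b)
  differentiableOn_time : ∀ p ∈ Set.Icc a b, DifferentiableOn ℝ (fun t => c p t) (timeInterval T)
  continuousOn : ContinuousOn (fun z : ℝ × ℝ => c z.1 z.2) (Set.Icc a b ×ˢ timeInterval T)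
  continuousOn_velocity : ContinuousOn
    (fun z : ℝ × ℝ => velocity a b (fun p => c p z.2) z.1) (Set.Icc a b ×ˢ timeInterval T)
  continuousOn_acceleration : ContinuousOn
    (fun z : ℝ × ℝ => acceleration a b (fun p => c p z.2) z.1) (Set.Icc a b ×ˢ timeInterval T)
  continuousOn_time : ContinuousOn
    (fun z : ℝ × ℝ => derivWithin (fun t => c z.1 t) (timeInterval T) z.2)
    (Set.Icc a b ×ˢ timeInterval T)
  smooth : ContDiffOn ℝ ∞ (fun z : ℝ × ℝ => c z.1 z.2)
    (Set.Icc a b ×ˢ (timeInterval T ∩ Set.Ioi 0))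
  regular : ∀ p ∈ Set.Icc a b, ∀ t ∈ timeInterval T, velocity a b (fun q => c q t) p ≠ 0
  flow : ∀ p ∈ Set.Icc a b, ∀ t ∈ timeInterval T,
    derivWithin (fun u => c p u) (timeInterval T) t =
      (curvature a b (fun q => c q t) p - averageCurvature a b (fun q => c q t)) •
        unitNormal a b (fun q => c q t) p
  initial : ∀ p ∈ Set.Icc a b, c p 0 = c₀ p
  left : ∀ t ∈ timeInterval T,
    MeetsAtAngle f (c a t) (unitTangent a b (fun q => c q t) a) (Real.pi / 2)
  right : ∀ t ∈ timeInterval T,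
    MeetsAtAngle f (c b t) (unitTangent a b (fun q => c q t) b) (-(Real.pi / 2))

end

/-! The length of a solution never increases, because its derivative is minus the integral of the
squared deviation of the curvature from its mean. Hence the length stays below the distance between
any two points of Σ with opposite tangents. If the total curvature were 2π at some time, the
tangents at the two ends would coincide, so the boundary angles would make the tangents of Σ there
opposite, and the curve would be too short to join its own end points (`totalCurvature_ne_two_pi`).
As the total curvature is continuous in time, it is enough to bound it at time 0.

This initial bound (`totalCurvature_lt_two_pi`) follows Hopf's proof of the rotation index theorem.
A simple curve has a continuous logarithm Θ(p,q) of its difference quotients, equal to one of the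
velocity on the diagonal, so the total curvature is the change of Im Θ along (a,a) → (a,b) → (b,b).
The chords from the starting point avoid the ray towards a point of Σ with opposite tangent: that
ray is first strictly inside Σ, where the curve never is, and then farther away than the curve is
long. The same holds at the end point. Both variations are thereby confined to intervals of length
2π. If the total were 2π + β with β ≥ 0, this would give β < π, while convexity of Σ gives sin β ≤
0. So β = 0, which is the excluded case of opposite tangents. -/

theorem Complex.inner_I_mul (z w : ℂ) :
    inner ℝ z (Complex.I * w) = z.im * w.re - z.re * w.im := by
  simp [Complex.inner]; ring

theorem Complex.eq_or_eq_neg_of_inner_I_mul_eq_zero {z w : ℂ} (hz : ‖z‖ = 1) (hw : ‖w‖ = 1)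
    (h : inner ℝ z (Complex.I * w) = 0) : z = w ∨ z = -w := by
  rw [Complex.inner_I_mul] at h
  have hz' : z.re * z.re + z.im * z.im = 1 := by
    rw [← Complex.normSq_apply, Complex.normSq_eq_norm_sq, hz, one_pow]
  have hw' : w.re * w.re + w.im * w.im = 1 := by
    rw [← Complex.normSq_apply, Complex.normSq_eq_norm_sq, hw, one_pow]
  set e := z.re * w.re + z.im * w.im with he
  have h1 : z.re = e * w.re := by rw [he]; linear_combination (-z.re) * hw' - w.im * h
  have h2 : z.im = e * w.im := by rw [he]; linear_combination (-z.im) * hw' + w.re * h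
  have h3 : e * e = 1 := by
    have : e * e * (w.re * w.re + w.im * w.im) = 1 := by
      rw [← hz', h1, h2]; ring
    rwa [hw', mul_one] at this
  rcases mul_self_eq_one_iff.1 h3 with h4 | h4
  · left; apply Complex.ext <;> simp [h1, h2, h4]
  · right; apply Complex.ext <;> simp [h1, h2, h4]

theorem oppositeTangentDist_le (f : ℝ → ℂ) {s u : ℝ} (h : deriv f s = -deriv f u) :
    oppositeTangentDist f ≤ ‖f s - f u‖ :=
  csInf_le ⟨0, by rintro _ ⟨_, _, _, rfl⟩; exact norm_nonneg _⟩ ⟨s, u, h, rfl⟩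

/-! ### Convex geometry of the support curve. -/

namespace IsSupportCurve

variable {f : ℝ → ℂ} {ℓ : ℝ}

theorem hasDerivAt (hf : IsSupportCurve f ℓ) (s : ℝ) : HasDerivAt f (deriv f s) s :=
  (hf.smooth.differentiable (by simp) s).hasDerivAt

theorem continuous_deriv (hf : IsSupportCurve f ℓ) : Continuous (deriv f) :=
  hf.smooth.continuous_deriv (by simp)

theorem hasDerivAt_inner (hf : IsSupportCurve f ℓ) (v : ℂ) (s : ℝ) :
    HasDerivAt (fun u => inner ℝ (f u) v) (inner ℝ (deriv f s) v) s := by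
  simpa using (hf.hasDerivAt s).inner ℝ (hasDerivAt_const s v)

theorem exists_forall_inner_le (hf : IsSupportCurve f ℓ) (v : ℂ) :
    ∃ s, (∀ u, inner ℝ (f u) v ≤ inner ℝ (f s) v) ∧ inner ℝ (deriv f s) v = 0 := by
  have hcont : Continuous fun u => inner ℝ (f u) v := hf.smooth.continuous.inner continuous_const
  obtain ⟨s, -, hs⟩ := isCompact_Icc.exists_isMaxOn
    (Set.nonempty_Icc.2 hf.period_pos.le) hcont.continuousOn
  have hmax : ∀ u, inner ℝ (f u) v ≤ inner ℝ (f s) v := by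
    intro u
    obtain ⟨r, hr, hur⟩ := hf.periodic.exists_mem_Ico₀ hf.period_pos u
    rw [hur]
    exact hs (Set.Ico_subset_Icc_self hr)
  refine ⟨s, hmax, ?_⟩
  have hloc : IsLocalMax (fun u => inner ℝ (f u) v) s := Filter.Eventually.of_forall hmax
  exact hloc.hasDerivAt_eq_zero (hf.hasDerivAt_inner v s)

/-- The curve lies in no line: otherwise its tangent would always be orthogonal to `v`, and at an
extremum in the direction `I * v` it would be orthogonal to both, though it has norm 1. -/
theorem exists_inner_sub_ne_zero (hf : IsSupportCurve f ℓ) (s : ℝ) {v : ℂ} (hv : v ≠ 0) :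
    ∃ u, inner ℝ (f u - f s) v ≠ 0 := by
  by_contra! h
  have h0 : ∀ u, inner ℝ (deriv f u) v = 0 := by
    intro u
    refine (hf.hasDerivAt_inner v u).unique ?_
    have : (fun u => inner ℝ (f u) v) = fun _ => inner ℝ (f s) v := by
      funext r
      have := h r
      rw [inner_sub_left] at this
      linarith
    rw [this]
    exact hasDerivAt_const u _
  obtain ⟨u, -, hu⟩ := hf.exists_forall_inner_le (Complex.I * v)
  have h1 := h0 u
  rw [Complex.inner_I_mul] at hu
  have h1' : (deriv f u).re * v.re + (deriv f u).im * v.im = 0 := by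
    rw [← h1]; simp [Complex.inner]; ring
  have hw' : (deriv f u).re * (deriv f u).re + (deriv f u).im * (deriv f u).im = 1 := by
    rw [← Complex.normSq_apply, Complex.normSq_eq_norm_sq, hf.arclength, one_pow]
  apply hv
  apply Complex.ext
  · simp only [Complex.zero_re]
    linear_combination (-v.re) * hw' + (deriv f u).re * h1' + (deriv f u).im * hu
  · simp only [Complex.zero_im]
    linear_combination (-v.im) * hw' + (deriv f u).im * h1' - (deriv f u).re * hu

theorem I_mul_deriv_ne_zero (hf : IsSupportCurve f ℓ) (s : ℝ) : Complex.I * deriv f s ≠ 0 := by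
  rw [← norm_ne_zero_iff, norm_mul, hf.arclength]; simp

/-- Otherwise the two supporting half planes, which face each other, would meet in at most a line,
and that line would contain the curve. -/
theorem inner_pos_of_deriv_eq_neg (hf : IsSupportCurve f ℓ) {s u : ℝ}
    (h : deriv f u = -deriv f s) : 0 < inner ℝ (f u - f s) (Complex.I * deriv f s) := by
  by_contra! hle
  obtain ⟨r, hr⟩ := hf.exists_inner_sub_ne_zero s (hf.I_mul_deriv_ne_zero s)
  have h1 := hf.convex u r
  have h2 := hf.convex s r
  rw [h, mul_neg, inner_neg_right] at h1
  have h3 : inner ℝ (f r - f s) (Complex.I * deriv f s) =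
      inner ℝ (f r - f u) (Complex.I * deriv f s) + inner ℝ (f u - f s) (Complex.I * deriv f s) := by
    rw [← inner_add_left]; congr 1; ring
  exact hr (by linarith)

/-- The point farthest from the tangent line at `s` has a parallel tangent; an equal tangent would
confine the curve to a line. -/
theorem exists_deriv_eq_neg (hf : IsSupportCurve f ℓ) (s : ℝ) : ∃ u, deriv f u = -deriv f s := by
  obtain ⟨u, hu, hu'⟩ := hf.exists_forall_inner_le (Complex.I * deriv f s)
  rcases Complex.eq_or_eq_neg_of_inner_I_mul_eq_zero (hf.arclength u) (hf.arclength s) hu' with h | h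
  · exfalso
    obtain ⟨r, hr⟩ := hf.exists_inner_sub_ne_zero u (hf.I_mul_deriv_ne_zero u)
    apply hr
    have h1 := hf.convex u r
    have h2 := hu r
    rw [← h] at h2
    rw [inner_sub_left] at h1 ⊢
    linarith
  · exact ⟨u, h⟩

theorem deriv_eq_of_inner_sub_eq_zero (hf : IsSupportCurve f ℓ) {s r : ℝ}
    (h : inner ℝ (f s - f r) (Complex.I * deriv f r) = 0) : deriv f s = deriv f r := by
  have hd : inner ℝ (deriv f s) (Complex.I * deriv f r) = 0 := by
    have hloc : IsLocalMin (fun u => inner ℝ (f u) (Complex.I * deriv f r)) s := by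
      refine Filter.Eventually.of_forall fun u => ?_
      have := hf.convex r u
      rw [inner_sub_left] at this h
      linarith
    exact hloc.hasDerivAt_eq_zero (hf.hasDerivAt_inner _ s)
  rcases Complex.eq_or_eq_neg_of_inner_I_mul_eq_zero (hf.arclength s) (hf.arclength r) hd with h1 | h1
  · exact h1
  · exact absurd (hf.inner_pos_of_deriv_eq_neg h1) (by rw [h]; exact lt_irrefl _)

theorem deriv_ne_neg_self (hf : IsSupportCurve f ℓ) (s : ℝ) : deriv f s ≠ -deriv f s := by
  intro h
  have h1 := hf.arclength s
  rw [eq_neg_iff_add_eq_zero, ← two_mul] at h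
  rcases mul_eq_zero.1 h with h | h
  · norm_num at h
  · simp [h] at h1

/-- If an interior point of the chord lay on the tangent line at `r`, so would both ends, and both
would have the tangent of `r`. -/
theorem inner_chord_pos (hf : IsSupportCurve f ℓ) {s u : ℝ} (h : deriv f u = -deriv f s)
    {k : ℝ} (hk0 : 0 < k) (hk1 : k < 1) (r : ℝ) :
    0 < inner ℝ (f s + (k : ℂ) * (f u - f s) - f r) (Complex.I * deriv f r) := by
  have h1 := hf.convex r s
  have h2 := hf.convex r u
  have key : inner ℝ (f s + (k : ℂ) * (f u - f s) - f r) (Complex.I * deriv f r) =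
      (1 - k) * inner ℝ (f s - f r) (Complex.I * deriv f r) +
        k * inner ℝ (f u - f r) (Complex.I * deriv f r) := by
    simp only [Complex.inner_I_mul]
    simp
    ring
  rw [key]
  by_contra! hle
  have h1' : inner ℝ (f s - f r) (Complex.I * deriv f r) = 0 := by nlinarith
  have h2' : inner ℝ (f u - f r) (Complex.I * deriv f r) = 0 := by nlinarith
  have e1 := hf.deriv_eq_of_inner_sub_eq_zero h1'
  have e2 := hf.deriv_eq_of_inner_sub_eq_zero h2'
  rw [e2, e1] at h
  exact hf.deriv_ne_neg_self r h

/-! ### Winding numbers -/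

/-- `2πi` times the winding number of `f` around `z`. -/
noncomputable def windingIntegral (f : ℝ → ℂ) (ℓ : ℝ) (z : ℂ) : ℂ :=
  ∫ s in (0 : ℝ)..ℓ, deriv f s / (f s - z)

theorem continuous_div_sub (hf : IsSupportCurve f ℓ) {z : ℂ} (hz : z ∉ Set.range f) :
    Continuous fun s => deriv f s / (f s - z) :=
  hf.continuous_deriv.div (hf.smooth.continuous.sub continuous_const)
    fun s h => hz ⟨s, sub_eq_zero.1 h⟩

/-- With W the primitive of f'/(f - z), the product (f - z) exp(-W) is constant, and f returns to
its initial value after one period. -/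
theorem exp_windingIntegral (hf : IsSupportCurve f ℓ) {z : ℂ} (hz : z ∉ Set.range f) :
    Complex.exp (windingIntegral f ℓ z) = 1 := by
  have hne : ∀ s, f s - z ≠ 0 := fun s h => hz ⟨s, sub_eq_zero.1 h⟩
  have hcont := hf.continuous_div_sub hz
  set W : ℝ → ℂ := fun t => ∫ s in (0 : ℝ)..t, deriv f s / (f s - z) with hW
  have hWd : ∀ t, HasDerivAt W (deriv f t / (f t - z)) t := fun t =>
    intervalIntegral.integral_hasDerivAt_right (hcont.intervalIntegrable _ _)
      hcont.stronglyMeasurable.stronglyMeasurableAtFilter hcont.continuousAt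
  have hconst : ∀ t, HasDerivAt (fun t => (f t - z) * Complex.exp (-W t)) 0 t := by
    intro t
    have h1 := ((hf.hasDerivAt t).sub_const z).mul (hWd t).neg.cexp
    convert! h1 using 1
    have := hne t
    field_simp
    ring
  have h2 := is_const_of_deriv_eq_zero (fun t => (hconst t).differentiableAt)
    (fun t => (hconst t).deriv) ℓ 0
  have h3 : f ℓ = f 0 := by simpa using hf.periodic 0
  simp only [h3, hW, intervalIntegral.integral_same, neg_zero, Complex.exp_zero, mul_one] at h2
  have h4 : Complex.exp (-windingIntegral f ℓ z) = 1 :=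
    mul_left_cancel₀ (hne 0) (by rw [mul_one]; exact h2)
  rw [Complex.exp_neg, inv_eq_one] at h4
  exact h4

theorem continuousOn_windingIntegral (hf : IsSupportCurve f ℓ) :
    ContinuousOn (windingIntegral f ℓ) (Set.range f)ᶜ := by
  rw [continuousOn_iff_continuous_domRestrict]
  apply intervalIntegral.continuous_parametric_intervalIntegral_of_continuous'
    (f := fun (z : ((Set.range f)ᶜ : Set ℂ)) s => deriv f s / (f s - z))
  apply Continuous.div
  · exact hf.continuous_deriv.comp continuous_snd
  · exact (hf.smooth.continuous.comp continuous_snd).sub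
      (continuous_subtype_val.comp continuous_fst)
  · rintro ⟨⟨z, hz⟩, s⟩ h
    exact hz ⟨s, sub_eq_zero.1 h⟩

/-- The imaginary part of the integrand is the quantity in `hz` divided by |f - z|². -/
theorem windingIntegral_im_pos (hf : IsSupportCurve f ℓ) {z : ℂ}
    (hz : ∀ r, 0 < inner ℝ (z - f r) (Complex.I * deriv f r)) :
    0 < (windingIntegral f ℓ z).im := by
  have hzr : z ∉ Set.range f := by
    rintro ⟨s, rfl⟩
    simpa using hz s
  have hcont := hf.continuous_div_sub hzr
  have him : (windingIntegral f ℓ z).im = ∫ s in (0 : ℝ)..ℓ, (deriv f s / (f s - z)).im :=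
    (Complex.imCLM.intervalIntegral_comp_comm (hcont.intervalIntegrable 0 ℓ)).symm
  rw [him]
  apply intervalIntegral.intervalIntegral_pos_of_pos
    ((Complex.continuous_im.comp hcont).intervalIntegrable _ _) _ hf.period_pos
  intro s
  have hne : f s - z ≠ 0 := fun h => hzr ⟨s, sub_eq_zero.1 h⟩
  have h1 := hz s
  rw [Complex.inner_I_mul] at h1
  rw [Function.comp_apply, Complex.div_im, ← sub_div]
  apply div_pos _ (Complex.normSq_pos.2 hne)
  simp at h1 ⊢
  linarith

theorem norm_windingIntegral_le_one (hf : IsSupportCurve f ℓ) {z : ℂ} {R : ℝ}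
    (hR : ∀ s, ‖f s‖ ≤ R) (hz : R + ℓ < ‖z‖) : ‖windingIntegral f ℓ z‖ ≤ 1 := by
  have h : ‖windingIntegral f ℓ z‖ ≤ ℓ⁻¹ * |ℓ - 0| := by
    apply intervalIntegral.norm_integral_le_of_norm_le_const
    intro s _
    rw [norm_div, hf.arclength, one_div]
    apply inv_anti₀ hf.period_pos
    have := norm_sub_norm_le z (f s)
    rw [norm_sub_rev]
    linarith [hR s]
  rwa [sub_zero, abs_of_pos hf.period_pos, inv_mul_cancel₀ hf.period_pos.ne'] at h

theorem exists_norm_le (hf : IsSupportCurve f ℓ) : ∃ R, ∀ s, ‖f s‖ ≤ R := by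
  obtain ⟨R, hR⟩ := isCompact_Icc.exists_bound_of_continuousOn
    (hf.smooth.continuous.continuousOn (s := Set.Icc 0 ℓ))
  refine ⟨R, fun s => ?_⟩
  obtain ⟨r, hr, hur⟩ := hf.periodic.exists_mem_Ico₀ hf.period_pos s
  rw [hur]
  exact hR r (Set.Ico_subset_Icc_self hr)

/-- The imaginary part of the winding integral is continuous off the curve, takes values in 2πℤ, is
positive at `z`, and is at most 1 far away. An unbounded component of `z` would force it through
forbidden values. -/
theorem notMem_outerDomain (hf : IsSupportCurve f ℓ) {z : ℂ}
    (hz : ∀ r, 0 < inner ℝ (z - f r) (Complex.I * deriv f r)) :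
    z ∉ outerDomain (Set.range f) := by
  rintro ⟨hzr, hub⟩
  obtain ⟨R, hR⟩ := hf.exists_norm_le
  obtain ⟨y, hy, hyR⟩ : ∃ y ∈ connectedComponentIn (Set.range f)ᶜ z, R + ℓ < ‖y‖ := by
    by_contra! h
    exact hub (isBounded_iff_forall_norm_le.2 ⟨_, h⟩)
  have hpc : IsPreconnected (connectedComponentIn (Set.range f)ᶜ z) :=
    isPreconnected_connectedComponentIn
  have hsub := connectedComponentIn_subset (Set.range f)ᶜ z
  have hcont : ContinuousOn (fun y => (windingIntegral f ℓ y).im)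
      (connectedComponentIn (Set.range f)ᶜ z) :=
    Complex.continuous_im.comp_continuousOn (hf.continuousOn_windingIntegral.mono hsub)
  have hint : ∀ y ∈ connectedComponentIn (Set.range f)ᶜ z,
      ∃ n : ℤ, (windingIntegral f ℓ y).im = n * (2 * Real.pi) := by
    intro y hy
    obtain ⟨n, hn⟩ := Complex.exp_eq_one_iff.1 (hf.exp_windingIntegral (hsub hy))
    exact ⟨n, by rw [hn]; simp⟩
  have hzm := mem_connectedComponentIn hzr
  have hpi := Real.pi_gt_three
  have hy1 : |(windingIntegral f ℓ y).im| ≤ 1 :=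
    (Complex.abs_im_le_norm _).trans (hf.norm_windingIntegral_le_one hR hyR)
  have hz1 : 2 * Real.pi ≤ (windingIntegral f ℓ z).im := by
    obtain ⟨n, hn⟩ := hint z hzm
    have h0 := hf.windingIntegral_im_pos hz
    rw [hn] at h0 ⊢
    have : (0 : ℝ) < n := pos_of_mul_pos_left h0 (by linarith)
    have : (1 : ℝ) ≤ n := by exact_mod_cast this
    nlinarith
  -- Any number strictly between 1 and 2π would serve in place of 3.
  obtain ⟨x, hx, hx3⟩ := hpc.intermediate_value hy hzm hcont
    (show (3 : ℝ) ∈ Set.Icc _ _ from ⟨by linarith [(abs_le.1 hy1).2], by linarith⟩)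
  obtain ⟨n, hn⟩ := hint x hx
  simp only at hx3
  rw [hn] at hx3
  have h0 : (0 : ℝ) < n :=
    pos_of_mul_pos_left (by rw [hx3]; norm_num) (by linarith : (0 : ℝ) ≤ 2 * Real.pi)
  have : (1 : ℝ) ≤ n := by exact_mod_cast h0
  nlinarith

end IsSupportCurve

/-- Lifting through the covering exp of the punctured plane. -/
theorem exists_continuous_exp_eq {X : Type*} [TopologicalSpace X] [SimplyConnectedSpace X]
    [LocallyPathConnectedSpace X] {g : X → ℂ} (hg : Continuous g) (h0 : ∀ x, g x ≠ 0) :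
    ∃ Θ : X → ℂ, Continuous Θ ∧ ∀ x, Complex.exp (Θ x) = g x := by
  obtain ⟨x₀⟩ : Nonempty X := inferInstance
  obtain ⟨F, ⟨-, hF⟩, -⟩ := Complex.isCoveringMapOn_exp.existsUnique_continuousMap_lifts
    ⟨g, hg⟩ (a₀ := x₀) (Complex.exp_log (h0 x₀)) (fun x => h0 x)
  exact ⟨F, F.continuous, fun x => congrFun hF x⟩

/-! ### Regular curves -/

section RegularCurve

variable {a b : ℝ} {γ : ℝ → ℂ}

theorem hasDerivWithinAt_velocity (hγ : ContDiffOn ℝ 2 γ (Set.Icc a b)) {p : ℝ}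
    (hp : p ∈ Set.Icc a b) : HasDerivWithinAt γ (velocity a b γ p) (Set.Icc a b) p :=
  (hγ.differentiableOn (by simp) p hp).hasDerivWithinAt

theorem contDiffOn_velocity (hab : a < b) (hγ : ContDiffOn ℝ 2 γ (Set.Icc a b)) :
    ContDiffOn ℝ 1 (velocity a b γ) (Set.Icc a b) :=
  hγ.derivWithin (uniqueDiffOn_Icc hab) (by norm_num)

theorem hasDerivWithinAt_acceleration (hab : a < b) (hγ : ContDiffOn ℝ 2 γ (Set.Icc a b)) {p : ℝ}
    (hp : p ∈ Set.Icc a b) :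
    HasDerivWithinAt (velocity a b γ) (acceleration a b γ p) (Set.Icc a b) p :=
  ((contDiffOn_velocity hab hγ).differentiableOn (by simp) p hp).hasDerivWithinAt

theorem continuousOn_acceleration (hab : a < b) (hγ : ContDiffOn ℝ 2 γ (Set.Icc a b)) :
    ContinuousOn (acceleration a b γ) (Set.Icc a b) :=
  (contDiffOn_velocity hab hγ).continuousOn_derivWithin (uniqueDiffOn_Icc hab) (by simp)

theorem integral_velocity (hab : a < b) (hγ : ContDiffOn ℝ 2 γ (Set.Icc a b)) {p q : ℝ}
    (hp : a ≤ p) (hpq : p ≤ q) (hq : q ≤ b) : ∫ r in p..q, velocity a b γ r = γ q - γ p := by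
  have hsub : Set.Icc p q ⊆ Set.Icc a b := Set.Icc_subset_Icc hp hq
  apply intervalIntegral.integral_eq_sub_of_hasDerivAt_of_le hpq (hγ.continuousOn.mono hsub)
  · intro r hr
    exact (hasDerivWithinAt_velocity hγ (hsub (Set.Ioo_subset_Icc_self hr))).hasDerivAt
      (Icc_mem_nhds (hp.trans_lt hr.1) (hr.2.trans_le hq))
  · apply ContinuousOn.intervalIntegrable
    rw [Set.uIcc_of_le hpq]
    exact (contDiffOn_velocity hab hγ).continuousOn.mono hsub

theorem norm_sub_le_curveLength (hab : a < b) (hγ : ContDiffOn ℝ 2 γ (Set.Icc a b)) {p q : ℝ}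
    (hp : a ≤ p) (hpq : p ≤ q) (hq : q ≤ b) : ‖γ q - γ p‖ ≤ curveLength a b γ := by
  rw [← integral_velocity hab hγ hp hpq hq]
  refine (intervalIntegral.norm_integral_le_integral_norm hpq).trans ?_
  apply intervalIntegral.integral_mono_interval hp hpq hq
  · exact Filter.Eventually.of_forall fun _ => norm_nonneg _
  · apply ContinuousOn.intervalIntegrable
    rw [Set.uIcc_of_le hab.le]
    exact (contDiffOn_velocity hab hγ).continuousOn.norm

theorem curvature_mul_norm_velocity (p : ℝ) :
    curvature a b γ p * ‖velocity a b γ p‖ = (acceleration a b γ p / velocity a b γ p).im := by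
  by_cases h : velocity a b γ p = 0
  · simp [h]
  have hn : ‖velocity a b γ p‖ ≠ 0 := norm_ne_zero_iff.2 h
  rw [Complex.div_im, Complex.normSq_eq_norm_sq, curvature, unitNormal, unitTangent,
    Complex.inner_I_mul]
  simp only [Complex.real_smul, Complex.mul_re, Complex.mul_im, Complex.ofReal_re,
    Complex.ofReal_im]
  field_simp
  ring

/-- The total curvature is the variation of every continuous argument of the velocity. -/
theorem totalCurvature_eq (hab : a < b) (hγ : ContDiffOn ℝ 2 γ (Set.Icc a b))
    (hreg : ∀ p ∈ Set.Icc a b, velocity a b γ p ≠ 0) {φ : ℝ → ℂ}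
    (hφ : ContinuousOn φ (Set.Icc a b))
    (hexp : ∀ p ∈ Set.Icc a b, Complex.exp (φ p) = velocity a b γ p) :
    totalCurvature a b γ = (φ b).im - (φ a).im := by
  have hcont : ContinuousOn (fun p => acceleration a b γ p / velocity a b γ p) (Set.Icc a b) :=
    (continuousOn_acceleration hab hγ).div (contDiffOn_velocity hab hγ).continuousOn hreg
  have hint : IntervalIntegrable (fun p => acceleration a b γ p / velocity a b γ p)
      MeasureTheory.volume a b := by
    apply ContinuousOn.intervalIntegrable
    rwa [Set.uIcc_of_le hab.le]
  -- The imaginary part of γ''/γ' is κ|γ'|. Since γ' exp(-W) is constant, `W` is a second logarithm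
  -- of γ' which agrees with `φ` at `a`, hence everywhere by uniqueness of lifts.
  set W : ℝ → ℂ := fun p => φ a + ∫ r in a..p, acceleration a b γ r / velocity a b γ r with hW
  have hWc : ContinuousOn W (Set.Icc a b) := by
    have h := intervalIntegral.continuousOn_primitive_interval' hint Set.left_mem_uIcc
    rw [Set.uIcc_of_le hab.le] at h
    exact continuousOn_const.add h
  have hWd : ∀ p ∈ Set.Ioo a b,
      HasDerivAt W (acceleration a b γ p / velocity a b γ p) p := by
    intro p hp
    have hn : Set.Icc a b ∈ nhds p := Icc_mem_nhds hp.1 hp.2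
    have hpI := Set.Ioo_subset_Icc_self hp
    refine (intervalIntegral.integral_hasDerivAt_right ?_ ?_ ?_).const_add _
    · apply hint.mono_set
      rw [Set.uIcc_of_le hab.le, Set.uIcc_of_le hp.1.le]
      exact Set.Icc_subset_Icc_right hp.2.le
    · exact (hcont.mono Set.Ioo_subset_Icc_self).stronglyMeasurableAtFilter isOpen_Ioo p hp
    · exact hcont.continuousAt hn
  have hconst : ∀ p ∈ Set.Icc a b, velocity a b γ p * Complex.exp (-W p) = 1 := by
    have hc : ContinuousOn (fun p => velocity a b γ p * Complex.exp (-W p)) (Set.Icc a b) :=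
      (contDiffOn_velocity hab hγ).continuousOn.mul hWc.neg.cexp
    have hd : ∀ p ∈ Set.Ioo a b,
        HasDerivAt (fun p => velocity a b γ p * Complex.exp (-W p)) 0 p := by
      intro p hp
      have h1 := ((hasDerivWithinAt_acceleration hab hγ (Set.Ioo_subset_Icc_self hp)).hasDerivAt
        (Icc_mem_nhds hp.1 hp.2)).mul (hWd p hp).neg.cexp
      convert! h1 using 1
      have := hreg p (Set.Ioo_subset_Icc_self hp)
      field_simp
      ring
    intro p hp
    have h := intervalIntegral.integral_eq_sub_of_hasDerivAt_of_le hp.1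
      (hc.mono (Set.Icc_subset_Icc_right hp.2))
      (fun r hr => hd r ⟨hr.1, hr.2.trans_le hp.2⟩) (by simp)
    rw [intervalIntegral.integral_zero, eq_comm, sub_eq_zero] at h
    rw [h]
    simp [hW, Complex.exp_neg, hexp a (Set.left_mem_Icc.2 hab.le),
      hreg a (Set.left_mem_Icc.2 hab.le)]
  have hWexp : ∀ p ∈ Set.Icc a b, Complex.exp (W p) = velocity a b γ p := by
    intro p hp
    have := hconst p hp
    rw [Complex.exp_neg] at this
    field_simp at this
    exact this.symm
  have heq : Set.EqOn φ W (Set.Icc a b) := by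
    apply Complex.isCoveringMap_exp.eqOn_of_comp_eqOn isPreconnected_Icc hφ hWc _
      (Set.left_mem_Icc.2 hab.le) (by simp [hW])
    intro p hp
    simp only [Function.comp_apply, Subtype.mk.injEq]
    rw [hexp p hp, hWexp p hp]
  rw [heq (Set.right_mem_Icc.2 hab.le)]
  simp only [hW, Complex.add_im, add_sub_cancel_left, totalCurvature]
  have him : (∫ p in a..b, acceleration a b γ p / velocity a b γ p).im =
      ∫ p in a..b, (acceleration a b γ p / velocity a b γ p).im :=
    (Complex.imCLM.intervalIntegral_comp_comm hint).symm
  rw [him]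
  simp_rw [curvature_mul_norm_velocity]

theorem exists_continuousOn_log_velocity (hab : a < b) (hγ : ContDiffOn ℝ 2 γ (Set.Icc a b))
    (hreg : ∀ p ∈ Set.Icc a b, velocity a b γ p ≠ 0) :
    ∃ φ : ℝ → ℂ, ContinuousOn φ (Set.Icc a b) ∧
      ∀ p ∈ Set.Icc a b, Complex.exp (φ p) = velocity a b γ p := by
  obtain ⟨φ, hφ, hexp⟩ := exists_continuous_exp_eq
    ((contDiffOn_velocity hab hγ).continuousOn.comp_continuous
      (continuous_subtype_val.comp (continuous_projIcc (h := hab.le))) fun p => Subtype.prop _)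
    fun p => hreg _ (Subtype.prop _)
  refine ⟨φ, hφ.continuousOn, fun p hp => ?_⟩
  rw [hexp]
  simp [Set.projIcc_of_mem hab.le hp]

/-- A continuous logarithm of the difference quotients of a regular curve without
self-intersection, extended to the diagonal by the velocity. -/
theorem exists_continuous_log_chord (hab : a < b) (hγ : ContDiffOn ℝ 2 γ (Set.Icc a b))
    (hreg : ∀ p ∈ Set.Icc a b, velocity a b γ p ≠ 0) (hinj : Set.InjOn γ (Set.Icc a b)) :
    ∃ Θ : ℝ × ℝ → ℂ, Continuous Θ ∧
      (∀ p ∈ Set.Icc a b, Complex.exp (Θ (p, p)) = velocity a b γ p) ∧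
      ∀ p ∈ Set.Icc a b, ∀ q ∈ Set.Icc a b, p < q →
        γ q - γ p = ((q - p : ℝ) : ℂ) * Complex.exp (Θ (p, q)) := by
  -- Clamping to [a, b] extends everything to the simply connected plane of pairs.
  set P : ℝ → ℝ := fun p => Set.projIcc a b hab.le p with hP
  have hPc : Continuous P := continuous_subtype_val.comp continuous_projIcc
  have hPm : ∀ p, P p ∈ Set.Icc a b := fun p => (Set.projIcc a b hab.le p).2
  have hPi : ∀ p ∈ Set.Icc a b, P p = p := fun p hp => by
    simp [hP, Set.projIcc_of_mem hab.le hp]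
  set w : ℝ → ℂ := fun p => velocity a b γ (P p) with hw
  have hwc : Continuous w :=
    (contDiffOn_velocity hab hγ).continuousOn.comp_continuous hPc hPm
  -- The mean velocity between the two parameters: the difference quotient off the diagonal, and
  -- visibly continuous across it.
  set G : ℝ × ℝ → ℂ := fun z => ∫ t in (0 : ℝ)..1, w ((P z.2 - P z.1) * t + P z.1) with hG
  have hGc : Continuous G := by
    apply intervalIntegral.continuous_parametric_intervalIntegral_of_continuous'
      (f := fun (z : ℝ × ℝ) t => w ((P z.2 - P z.1) * t + P z.1))
    refine hwc.comp ?_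
    fun_prop
  have hGd : ∀ p q, P p = P q → G (p, q) = velocity a b γ (P p) := by
    intro p q h
    have : P (P p) = P p := hPi _ (hPm p)
    simp only [hG, hw, ← h, sub_self, zero_mul, zero_add, this]
    simp
  have hGlt : ∀ p q, P p ≠ P q → γ (P q) - γ (P p) = ((P q - P p : ℝ) : ℂ) * G (p, q) := by
    have hlt : ∀ p q, P p < P q → γ (P q) - γ (P p) = ∫ t in P p..P q, w t := by
      intro p q h
      rw [← integral_velocity hab hγ (hPm p).1 h.le (hPm q).2]
      apply intervalIntegral.integral_congr
      intro t ht
      rw [Set.uIcc_of_le h.le] at ht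
      simp only [hw]
      rw [hPi t (Set.Icc_subset_Icc (hPm p).1 (hPm q).2 ht)]
    intro p q h
    have h0 : P q - P p ≠ 0 := sub_ne_zero.2 h.symm
    have h1 : G (p, q) = (P q - P p)⁻¹ • ∫ t in P p..P q, w t := by
      simp only [hG]
      rw [intervalIntegral.integral_comp_mul_add w h0]
      simp
    rw [h1, Complex.real_smul, ← mul_assoc, ← Complex.ofReal_mul, mul_inv_cancel₀ h0,
      Complex.ofReal_one, one_mul]
    rcases h.lt_or_gt with h | h
    · exact hlt p q h
    · rw [intervalIntegral.integral_symm, ← hlt q p h]; ring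
  have hG0 : ∀ z, G z ≠ 0 := by
    rintro ⟨p, q⟩ h0
    by_cases h : P p = P q
    · exact hreg _ (hPm p) ((hGd p q h).symm.trans h0)
    · have h1 := hGlt p q h
      rw [h0, mul_zero, sub_eq_zero] at h1
      exact h (hinj (hPm q) (hPm p) h1).symm
  obtain ⟨Θ, hΘ, hexp⟩ := exists_continuous_exp_eq hGc hG0
  refine ⟨Θ, hΘ, fun p hp => ?_, fun p hp q hq hpq => ?_⟩
  · rw [hexp, hGd p p rfl, hPi p hp]
  · have h := hGlt p q (by rw [hPi p hp, hPi q hq]; exact hpq.ne)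
    rw [hPi p hp, hPi q hq] at h
    rw [hexp, h]

end RegularCurve

/-! ### Arguments of chords, and the bound for the initial curve. -/

/-- If a continuous function `r exp (i φ)` avoids the ray spanned by `u`, and starts in the open
half plane opposite to `u`, then its argument is confined to an interval of length `2π`. -/
theorem exists_arg_variation_mem_Ioo {φ : ℝ → ℝ} {p₀ p₁ : ℝ} (hφ : ContinuousOn φ (Set.uIcc p₀ p₁))
    {u : ℂ} (hu : inner ℝ u (Complex.exp (φ p₀ * Complex.I)) < 0)
    (havoid : ∀ p ∈ Set.uIcc p₀ p₁, ∀ r : ℝ, 0 < r →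
      Complex.exp (φ p * Complex.I) ≠ (r : ℂ) * u) :
    ∃ δ : ℝ, |δ| < Real.pi / 2 ∧
      u = (‖u‖ : ℂ) * Complex.exp (((φ p₀ + Real.pi + δ : ℝ) : ℂ) * Complex.I) ∧
      φ p₁ - φ p₀ ∈ Set.Ioo (δ - Real.pi) (δ + Real.pi) := by
  set e := Complex.exp (φ p₀ * Complex.I) with he
  have hu0 : u ≠ 0 := by rintro rfl; simp at hu
  have hn : ‖u‖ ≠ 0 := norm_ne_zero_iff.2 hu0
  have hn' : (‖u‖ : ℂ) ≠ 0 := Complex.ofReal_ne_zero.2 hn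
  have hconj : Complex.exp (-(φ p₀ * Complex.I)) = starRingEnd ℂ e := by
    rw [he, ← Complex.exp_conj]; simp
  -- This is `-u` in the frame turned by `φ p₀`. Its real part is positive by `hu`, so its argument
  -- serves as δ.
  set z := -u * Complex.exp (-(φ p₀ * Complex.I)) with hz
  have hzn : ‖z‖ = ‖u‖ := by
    rw [hz, ← neg_mul, ← Complex.ofReal_neg, norm_mul, Complex.norm_exp_ofReal_mul_I, norm_neg,
      mul_one]
  have hzre : 0 < z.re := by
    rw [hz, hconj]
    simp [Complex.inner] at hu ⊢
    linarith
  have hδ : |z.arg| < Real.pi / 2 := Complex.abs_arg_lt_pi_div_two_iff.2 (Or.inl hzre)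
  have hzu : u = -((‖u‖ : ℂ) * Complex.exp (((φ p₀ + z.arg : ℝ) : ℂ) * Complex.I)) := by
    have h1 := Complex.norm_mul_exp_arg_mul_I z
    rw [hzn] at h1
    rw [Complex.ofReal_add, add_mul, Complex.exp_add]
    have : (‖u‖ : ℂ) * (Complex.exp (φ p₀ * Complex.I) * Complex.exp (z.arg * Complex.I)) =
        Complex.exp (φ p₀ * Complex.I) * z := by
      linear_combination Complex.exp (φ p₀ * Complex.I) * h1
    rw [this, hz, Complex.exp_neg]
    field_simp
  -- At these two values of the argument the function would point along `u`; continuity keeps `φ`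
  -- between them.
  have hne : ∀ p ∈ Set.uIcc p₀ p₁, ∀ k : ℝ, (k = Real.pi ∨ k = -Real.pi) →
      φ p ≠ φ p₀ + z.arg + k := by
    intro p hp k hk h
    apply havoid p hp ‖u‖⁻¹ (by positivity)
    have hk' : Complex.exp (k * Complex.I) = -1 := by
      rcases hk with rfl | rfl
      · exact Complex.exp_pi_mul_I
      · rw [Complex.ofReal_neg, neg_mul, Complex.exp_neg, Complex.exp_pi_mul_I]; norm_num
    rw [h, Complex.ofReal_add, add_mul, Complex.exp_add, hk']
    rw [mul_neg_one, eq_comm, Complex.ofReal_inv, inv_mul_eq_iff_eq_mul₀ hn', mul_neg]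
    exact hzu
  refine ⟨z.arg, hδ, ?_, ?_⟩
  · nth_rewrite 1 [hzu]
    rw [show φ p₀ + Real.pi + z.arg = (φ p₀ + z.arg) + Real.pi by ring,
      Complex.ofReal_add (_ + _), add_mul, Complex.exp_add, Complex.exp_pi_mul_I]
    ring
  · obtain ⟨h1, h2⟩ := abs_lt.1 hδ
    have hpi := Real.pi_pos
    constructor
    · by_contra! hle
      obtain ⟨p, hp, hpe⟩ := intermediate_value_uIcc hφ
        (show φ p₀ + z.arg + -Real.pi ∈ Set.uIcc (φ p₀) (φ p₁) by
          rw [Set.uIcc_of_ge (by linarith)]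
          constructor <;> linarith)
      exact hne p hp _ (Or.inr rfl) hpe
    · by_contra! hle
      obtain ⟨p, hp, hpe⟩ := intermediate_value_uIcc hφ
        (show φ p₀ + z.arg + Real.pi ∈ Set.uIcc (φ p₀) (φ p₁) by
          rw [Set.uIcc_of_le (by linarith)]
          constructor <;> linarith)
      exact hne p hp _ (Or.inl rfl) hpe

theorem norm_unitTangent {a b : ℝ} {γ : ℝ → ℂ} {p : ℝ} (h : velocity a b γ p ≠ 0) :
    ‖unitTangent a b γ p‖ = 1 := by
  rw [unitTangent, norm_smul, norm_inv, norm_norm, inv_mul_cancel₀ (norm_ne_zero_iff.2 h)]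

theorem unitTangent_eq_exp {a b : ℝ} {γ : ℝ → ℂ} {p : ℝ} {z : ℂ}
    (h : Complex.exp z = velocity a b γ p) :
    unitTangent a b γ p = Complex.exp ((z.im : ℂ) * Complex.I) := by
  rw [unitTangent, ← h, Complex.norm_exp, Complex.real_smul, Complex.ofReal_inv,
    Complex.ofReal_exp, ← Complex.exp_neg, ← Complex.exp_add]
  congr 1
  nth_rewrite 2 [← Complex.re_add_im z]
  ring

theorem MeetsAtAngle.exists_eq {f : ℝ → ℂ} {ℓ : ℝ} (hf : IsSupportCurve f ℓ) {x v : ℂ}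
    {θ : ℝ} (hv : ‖v‖ = 1) (hθ : θ ∈ Set.Ioc (-Real.pi) Real.pi) (h : MeetsAtAngle f x v θ) :
    ∃ s, f s = x ∧ deriv f s = Complex.exp ((θ : ℂ) * Complex.I) * v := by
  obtain ⟨s, hs, ha⟩ := h
  refine ⟨s, hs, ?_⟩
  rw [Complex.oangle] at ha
  have harg := congrArg Real.Angle.toReal ha
  rw [Complex.arg_coe_angle_toReal_eq_arg, Real.Angle.toReal_coe_eq_self_iff.2 hθ] at harg
  have h1 := Complex.norm_mul_exp_arg_mul_I (starRingEnd ℂ v * deriv f s)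
  rw [harg, norm_mul, RCLike.norm_conj, hv, hf.arclength, mul_one, Complex.ofReal_one,
    one_mul] at h1
  have h2 : v * starRingEnd ℂ v = 1 := by
    rw [Complex.mul_conj, Complex.normSq_eq_norm_sq, hv]; norm_num
  rw [h1]
  linear_combination (-deriv f s) * h2

theorem MeetsAtAngle.exists_deriv_eq_I_mul {f : ℝ → ℂ} {ℓ : ℝ} (hf : IsSupportCurve f ℓ) {x v : ℂ}
    (hv : ‖v‖ = 1) (h : MeetsAtAngle f x v (Real.pi / 2)) :
    ∃ s, f s = x ∧ deriv f s = Complex.I * v := by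
  have hpi := Real.pi_pos
  obtain ⟨s, hs, h1⟩ := h.exists_eq hf hv ⟨by linarith, by linarith⟩
  refine ⟨s, hs, ?_⟩
  rw [h1, Complex.ofReal_div, Complex.ofReal_ofNat, Complex.exp_pi_div_two_mul_I]

theorem MeetsAtAngle.exists_deriv_eq_neg_I_mul {f : ℝ → ℂ} {ℓ : ℝ} (hf : IsSupportCurve f ℓ)
    {x v : ℂ} (hv : ‖v‖ = 1) (h : MeetsAtAngle f x v (-(Real.pi / 2))) :
    ∃ s, f s = x ∧ deriv f s = -(Complex.I * v) := by
  have hpi := Real.pi_pos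
  obtain ⟨s, hs, h1⟩ := h.exists_eq hf hv ⟨by linarith, by linarith⟩
  refine ⟨s, hs, ?_⟩
  rw [h1, Complex.ofReal_neg, Complex.ofReal_div, Complex.ofReal_ofNat, neg_mul, Complex.exp_neg,
    Complex.exp_pi_div_two_mul_I, Complex.inv_I, neg_mul]

/-- Points outside of a support curve that are close to `f s` do not lie on the ray from `f s`
through a point with opposite tangent. -/
theorem IsSupportCurve.ne_add_mul_sub {f : ℝ → ℂ} {ℓ : ℝ} (hf : IsSupportCurve f ℓ) {s u : ℝ}
    (h : deriv f u = -deriv f s) {z : ℂ}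
    (hz : z ∈ Set.range f ∨ z ∈ outerDomain (Set.range f))
    (hd : ‖z - f s‖ < oppositeTangentDist f) {k : ℝ} (hk : 0 < k) :
    z ≠ f s + (k : ℂ) * (f u - f s) := by
  rintro rfl
  -- For k < 1 the point is strictly inside the curve; for k ≥ 1 it is at least as far from `f s` as
  -- `f u` is.
  rcases lt_or_ge k 1 with h1 | h1
  · have hpos := hf.inner_chord_pos h hk h1
    rcases hz with ⟨r, hr⟩ | hz
    · have := hpos r
      rw [← hr] at this
      simp at this
    · exact hf.notMem_outerDomain hpos hz
  · have h2 := oppositeTangentDist_le f h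
    rw [add_sub_cancel_left, norm_mul, Complex.norm_real, Real.norm_of_nonneg hk.le] at hd
    nlinarith [norm_nonneg (f u - f s)]

theorem Complex.im_conj_mul_exp_eq (x y φ ψ : ℝ) :
    (starRingEnd ℂ ((x : ℂ) * Complex.exp ((φ : ℂ) * Complex.I)) *
      ((y : ℂ) * Complex.exp ((ψ : ℂ) * Complex.I))).im = x * y * Real.sin (ψ - φ) := by
  rw [Real.sin_sub]
  simp [Complex.exp_ofReal_mul_I_re, Complex.exp_ofReal_mul_I_im]
  ring

/-- Multiplying `h1` by `h4` and `h2` by `h3`, the sum of the products collapses to -sin β (v ×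
u)|x|². In the application, `x` and its rotation by β are the end tangents, and the four
inequalities say that Σ lies on one side of its tangent lines. -/
theorem sin_nonpos_of_inner_nonneg {u v x : ℂ} {β : ℝ} (hx : ‖x‖ = 1)
    (h3 : inner ℝ v x ≤ 0) (h4 : 0 ≤ inner ℝ (v - u) x)
    (h1 : 0 ≤ inner ℝ (-v) (Complex.exp ((β : ℂ) * Complex.I) * x))
    (h2 : 0 ≤ inner ℝ (u - v) (Complex.exp ((β : ℂ) * Complex.I) * x))
    (hcross : 0 < (starRingEnd ℂ v * u).im) : Real.sin β ≤ 0 := by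
  have hxn : x.re * x.re + x.im * x.im = 1 := by
    rw [← Complex.normSq_apply, Complex.normSq_eq_norm_sq, hx, one_pow]
  have h5 := mul_nonneg h1 h4
  have h6 := mul_nonneg h2 (neg_nonneg.2 h3)
  have key : inner ℝ (-v) (Complex.exp ((β : ℂ) * Complex.I) * x) * inner ℝ (v - u) x +
      inner ℝ (u - v) (Complex.exp ((β : ℂ) * Complex.I) * x) * -inner ℝ v x =
      -(Real.sin β * (starRingEnd ℂ v * u).im * (x.re * x.re + x.im * x.im)) := by
    simp only [Complex.inner, Complex.mul_re, Complex.mul_im, Complex.exp_ofReal_mul_I_re,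
      Complex.exp_ofReal_mul_I_im, Complex.conj_re, Complex.conj_im, map_neg, map_sub,
      Complex.neg_re, Complex.neg_im, Complex.sub_re, Complex.sub_im]
    ring
  rw [hxn, mul_one] at key
  by_contra! hpos
  nlinarith [mul_pos hpos hcross]

/-- A curve without self-intersection that leaves a support curve orthogonally, runs outside of it and
returns to it orthogonally, and is too short to connect points with opposite tangents, has total
curvature less than `2π`. -/
theorem totalCurvature_lt_two_pi {f : ℝ → ℂ} {ℓ : ℝ} (hf : IsSupportCurve f ℓ) {a b : ℝ}
    (hab : a < b) {γ : ℝ → ℂ} (hγ : ContDiffOn ℝ 2 γ (Set.Icc a b))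
    (hreg : ∀ p ∈ Set.Icc a b, velocity a b γ p ≠ 0) (hinj : Set.InjOn γ (Set.Icc a b))
    (hleft : MeetsAtAngle f (γ a) (unitTangent a b γ a) (Real.pi / 2))
    (hright : MeetsAtAngle f (γ b) (unitTangent a b γ b) (-(Real.pi / 2)))
    (houter : ∀ p ∈ Set.Ioo a b, γ p ∈ outerDomain (Set.range f))
    (hlength : curveLength a b γ < oppositeTangentDist f) :
    totalCurvature a b γ < 2 * Real.pi := by
  have ha := Set.left_mem_Icc.2 hab.le
  have hb := Set.right_mem_Icc.2 hab.le
  have hpi := Real.pi_pos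
  obtain ⟨Θ, hΘ, hdiag, hchord⟩ := exists_continuous_log_chord hab hγ hreg hinj
  obtain ⟨s, hs, hds⟩ := hleft.exists_deriv_eq_I_mul hf (norm_unitTangent (hreg a ha))
  obtain ⟨t, ht, hdt⟩ := hright.exists_deriv_eq_neg_I_mul hf (norm_unitTangent (hreg b hb))
  obtain ⟨s', hs'⟩ := hf.exists_deriv_eq_neg s
  obtain ⟨t', ht'⟩ := hf.exists_deriv_eq_neg t
  have hτa := unitTangent_eq_exp (hdiag a ha)
  have hτb := unitTangent_eq_exp (hdiag b hb)
  -- `I * deriv f` is the inner normal of Σ: the curve leaves against it and arrives along it.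
  have hIa : Complex.I * deriv f s = -unitTangent a b γ a := by
    rw [hds]; linear_combination unitTangent a b γ a * Complex.I_mul_I
  have hIb : Complex.I * deriv f t = unitTangent a b γ b := by
    rw [hdt]; linear_combination -unitTangent a b γ b * Complex.I_mul_I
  have htotal := totalCurvature_eq hab hγ hreg
    (hΘ.comp (Continuous.prodMk continuous_id continuous_id)).continuousOn hdiag
  simp only [Function.comp_apply, id_eq] at htotal
  have hmem : ∀ p ∈ Set.Icc a b, γ p ∈ Set.range f ∨ γ p ∈ outerDomain (Set.range f) := by
    intro p hp
    rcases hp.1.eq_or_lt with rfl | h1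
    · exact Or.inl ⟨s, hs⟩
    rcases hp.2.eq_or_lt with rfl | h2
    · exact Or.inl ⟨t, ht⟩
    exact Or.inr (houter p ⟨h1, h2⟩)
  have hexp : ∀ z : ℂ, Complex.exp z =
      ((Real.exp z.re : ℝ) : ℂ) * Complex.exp ((z.im : ℂ) * Complex.I) := by
    intro z
    rw [Complex.ofReal_exp, ← Complex.exp_add, Complex.re_add_im]
  -- the chords from the starting point
  have hu1 := hf.inner_pos_of_deriv_eq_neg hs'
  rw [hIa, inner_neg_right, neg_pos] at hu1
  obtain ⟨δ, hδ, hu, hA⟩ := exists_arg_variation_mem_Ioo (φ := fun p => (Θ (a, p)).im)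
    (p₀ := a) (p₁ := b) (Complex.continuous_im.comp (hΘ.comp (by fun_prop))).continuousOn
    (u := f s' - f s) (by rw [← hτa]; exact hu1) (by
      rw [Set.uIcc_of_le hab.le]
      intro p hp r hr h
      rcases hp.1.eq_or_lt with rfl | h1
      · rw [← hτa] at h
        have h2 : inner ℝ (unitTangent a b γ a) (unitTangent a b γ a) =
            r * inner ℝ (f s' - f s) (unitTangent a b γ a) := by
          nth_rewrite 1 [h]
          rw [← Complex.real_smul, real_inner_smul_left]
        rw [real_inner_self_eq_norm_sq] at h2
        nlinarith [sq_nonneg ‖unitTangent a b γ a‖]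
      · refine hf.ne_add_mul_sub hs' (hmem p hp) ?_
          (mul_pos (mul_pos (sub_pos.2 h1) (Real.exp_pos (Θ (a, p)).re)) hr) ?_
        · rw [hs]
          exact (norm_sub_le_curveLength hab hγ le_rfl hp.1 hp.2).trans_lt hlength
        · have h2 := hchord a ha p hp h1
          rw [hexp, h] at h2
          rw [hs] at h2 ⊢
          push_cast at h2 ⊢
          linear_combination h2)
  -- the chords to the end point
  have hu2 := hf.inner_pos_of_deriv_eq_neg ht'
  rw [hIb] at hu2
  -- The chords now point towards the base point `γ b`, so the forbidden direction changes sign.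
  obtain ⟨δ', hδ', -, hB⟩ := exists_arg_variation_mem_Ioo (φ := fun p => (Θ (p, b)).im)
    (p₀ := b) (p₁ := a) (Complex.continuous_im.comp (hΘ.comp (by fun_prop))).continuousOn
    (u := -(f t' - f t)) (by rw [← hτb, inner_neg_left]; linarith) (by
      rw [Set.uIcc_of_ge hab.le]
      intro p hp r hr h
      rcases hp.2.eq_or_lt with rfl | h1
      · rw [← hτb] at h
        have h2 : inner ℝ (unitTangent a p γ p) (unitTangent a p γ p) =
            r * -inner ℝ (f t' - f t) (unitTangent a p γ p) := by
          nth_rewrite 1 [h]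
          rw [← Complex.real_smul, real_inner_smul_left, inner_neg_left]
        rw [real_inner_self_eq_norm_sq] at h2
        nlinarith [sq_nonneg ‖unitTangent a p γ p‖]
      · refine hf.ne_add_mul_sub ht' (hmem p hp) ?_
          (mul_pos (mul_pos (sub_pos.2 h1) (Real.exp_pos (Θ (p, b)).re)) hr) ?_
        · rw [ht, norm_sub_rev]
          exact (norm_sub_le_curveLength hab hγ hp.1 hp.2 le_rfl).trans_lt hlength
        · have h2 := hchord p hp b hb h1
          rw [hexp, h] at h2
          rw [ht] at h2 ⊢
          push_cast at h2 ⊢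
          linear_combination -h2)
  simp only [Set.mem_Ioo] at hA hB
  obtain ⟨hδ1, hδ2⟩ := abs_lt.1 hδ
  obtain ⟨hδ1', hδ2'⟩ := abs_lt.1 hδ'
  by_contra! hge
  rw [htotal] at hge
  -- signs of the coordinates of `u = f s' - f s` and `v = f t - f s`
  set u := f s' - f s with hudef
  set v := f t - f s with hvdef
  have hv : v = (((b - a) * Real.exp (Θ (a, b)).re : ℝ) : ℂ) *
      Complex.exp (((Θ (a, b)).im : ℂ) * Complex.I) := by
    rw [hvdef, hs, ht, hchord a ha b hb hab, hexp, Complex.ofReal_mul, mul_assoc]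
  have hun : 0 < ‖u‖ := by
    apply norm_pos_iff.2
    intro h0
    rw [h0, inner_zero_left] at hu1
    exact lt_irrefl _ hu1
  -- The angle from `v` to `u` is π + δ - A, with A the variation in `hA`. It is positive by `hA`;
  -- it is below π because `hge` and `hB` give A > π + δ' > π/2 > δ.
  have hcross : 0 < (starRingEnd ℂ v * u).im := by
    rw [hv, hu, Complex.im_conj_mul_exp_eq]
    apply mul_pos (mul_pos (mul_pos (sub_pos.2 hab) (Real.exp_pos _)) _)
    · apply Real.sin_pos_of_pos_of_lt_pi <;> linarith
    · exact hun
  set x := unitTangent a b γ a with hx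
  set y := unitTangent a b γ b with hy
  set β := (Θ (b, b)).im - (Θ (a, a)).im - 2 * Real.pi with hβ
  have hyx : y = Complex.exp ((β : ℂ) * Complex.I) * x := by
    rw [hτa, hτb, ← Complex.exp_add, hβ, ← Complex.exp_periodic.sub_eq]
    congr 1
    push_cast
    ring
  have c1 := hf.convex t s
  have c2 := hf.convex t s'
  have c3 := hf.convex s t
  have c4 := hf.convex s' t
  rw [hIb] at c1 c2
  rw [hIa] at c3
  rw [hs', mul_neg, hIa, neg_neg] at c4
  have e1 : f s - f t = -v := by rw [hvdef]; ring
  have e2 : f s' - f t = u - v := by rw [hudef, hvdef]; ring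
  have e4 : f t - f s' = v - u := by rw [hudef, hvdef]; ring
  rw [e1, hyx] at c1
  rw [e2, hyx] at c2
  rw [e4] at c4
  have hsin : Real.sin β ≤ 0 := by
    rw [inner_neg_right] at c3
    exact sin_nonpos_of_inner_nonneg (norm_unitTangent (hreg a ha)) (by linarith) c4 c1 c2 hcross
  -- `hA` and `hB` give β < δ - δ' < π, and β ≥ 0 by `hge`.
  have hβ0 : β = 0 := by
    by_contra hne
    have hpos : 0 < β := lt_of_le_of_ne (by linarith) (Ne.symm hne)
    exact absurd (Real.sin_pos_of_pos_of_lt_pi hpos (by linarith)) (not_lt.2 hsin)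
  rw [hβ0, Complex.ofReal_zero, zero_mul, Complex.exp_zero, one_mul] at hyx
  have hopp : deriv f t = -deriv f s := by rw [hdt, hds, hyx]
  have h1 := oppositeTangentDist_le f hopp
  rw [hs, ht] at h1
  exact absurd (h1.trans (norm_sub_le_curveLength hab hγ le_rfl hab.le le_rfl)) (not_le.2 hlength)

/-! ### Evolution of length and total curvature under the flow. -/

theorem continuousOn_intervalIntegral {E : Type*} [NormedAddCommGroup E] [NormedSpace ℝ E]
    {a b : ℝ} (hab : a ≤ b) {X : Type*} [TopologicalSpace X] {S : Set X} {g : ℝ → X → E}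
    (hg : ContinuousOn (fun z : ℝ × X => g z.1 z.2) (Set.Icc a b ×ˢ S)) :
    ContinuousOn (fun t => ∫ p in a..b, g p t) S := by
  rw [continuousOn_iff_continuous_domRestrict]
  have h : Continuous fun t : S => ∫ p in a..b, g (Set.projIcc a b hab p) t := by
    apply intervalIntegral.continuous_parametric_intervalIntegral_of_continuous'
      (f := fun (t : S) p => g (Set.projIcc a b hab p) t)
    refine hg.comp_continuous (f := fun z : S × ℝ => ((Set.projIcc a b hab z.2 : ℝ), (z.1 : X)))
      ?_ ?_
    · exact (continuous_subtype_val.comp (continuous_projIcc.comp continuous_snd)).prodMk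
        (continuous_subtype_val.comp continuous_fst)
    · exact fun z => ⟨(Set.projIcc a b hab z.2).2, z.1.2⟩
  convert! h using 2 with t
  apply intervalIntegral.integral_congr
  intro p hp
  rw [Set.uIcc_of_le hab] at hp
  simp [Set.projIcc_of_mem hab hp]

theorem isOpen_timeInterval_inter_Ioi (T : EReal) : IsOpen (timeInterval T ∩ Set.Ioi 0) := by
  have : timeInterval T ∩ Set.Ioi 0 = {t : ℝ | (t : EReal) < T} ∩ Set.Ioi 0 := by
    ext t
    simp only [timeInterval, Set.mem_inter_iff, Set.mem_ofPred_eq, Set.mem_Ioi]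
    constructor
    · rintro ⟨⟨-, h⟩, h'⟩; exact ⟨h, h'⟩
    · rintro ⟨h, h'⟩; exact ⟨⟨h'.le, h⟩, h'⟩
  rw [this]
  exact (isOpen_Iio.preimage continuous_coe_real_ereal).inter isOpen_Ioi

theorem ordConnected_timeInterval (T : EReal) : (timeInterval T).OrdConnected :=
  ⟨fun _ hx _ hy _ hz =>
    ⟨hx.1.trans hz.1, (EReal.coe_le_coe_iff.2 hz.2).trans_lt hy.2⟩⟩

theorem inner_unitNormal_velocity (a b : ℝ) (γ : ℝ → ℂ) (p : ℝ) :
    inner ℝ (unitNormal a b γ p) (velocity a b γ p) = 0 := by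
  rw [real_inner_comm, unitNormal, unitTangent, Complex.inner_I_mul]
  simp
  ring

theorem inner_unitNormal_acceleration {a b : ℝ} {γ : ℝ → ℂ} {p : ℝ} (h : velocity a b γ p ≠ 0) :
    inner ℝ (unitNormal a b γ p) (acceleration a b γ p) =
      curvature a b γ p * ‖velocity a b γ p‖ ^ 2 := by
  have hn : ‖velocity a b γ p‖ ≠ 0 := norm_ne_zero_iff.2 h
  rw [curvature, real_inner_comm]
  field_simp

theorem curveLength_pos {a b : ℝ} (hab : a < b) {γ : ℝ → ℂ} (hγ : ContDiffOn ℝ 2 γ (Set.Icc a b))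
    (hreg : ∀ p ∈ Set.Icc a b, velocity a b γ p ≠ 0) : 0 < curveLength a b γ := by
  apply intervalIntegral.intervalIntegral_pos_of_pos_on _ _ hab
  · apply ContinuousOn.intervalIntegrable
    rw [Set.uIcc_of_le hab.le]
    exact (contDiffOn_velocity hab hγ).continuousOn.norm
  · exact fun p hp => norm_pos_iff.2 (hreg p (Set.Ioo_subset_Icc_self hp))

namespace IsSolution

variable {f : ℝ → ℂ} {a b : ℝ} {c₀ : ℝ → ℂ} {T : EReal} {c : ℝ → ℝ → ℂ}

theorem continuousOn_curvature (hc : IsSolution f a b c₀ T c) :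
    ContinuousOn (fun z : ℝ × ℝ => curvature a b (fun p => c p z.2) z.1)
      (Set.Icc a b ×ˢ timeInterval T) := by
  have hne : ∀ z ∈ Set.Icc a b ×ˢ timeInterval T,
      ‖velocity a b (fun p => c p z.2) z.1‖ ≠ 0 := fun z hz =>
    norm_ne_zero_iff.2 (hc.regular _ hz.1 _ hz.2)
  have hv := hc.continuousOn_velocity
  unfold curvature unitNormal unitTangent
  exact (hc.continuousOn_acceleration.inner (continuousOn_const.mul
    ((hv.norm.inv₀ hne).smul hv))).div (hv.norm.pow 2) fun z hz => pow_ne_zero 2 (hne z hz)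

theorem continuousOn_curveLength (hc : IsSolution f a b c₀ T c) (hab : a < b) :
    ContinuousOn (fun t => curveLength a b (fun p => c p t)) (timeInterval T) :=
  continuousOn_intervalIntegral (g := fun p t => ‖velocity a b (fun q => c q t) p‖) hab.le
    hc.continuousOn_velocity.norm

theorem continuousOn_totalCurvature (hc : IsSolution f a b c₀ T c) (hab : a < b) :
    ContinuousOn (fun t => totalCurvature a b (fun p => c p t)) (timeInterval T) :=
  continuousOn_intervalIntegral (g := fun p t => curvature a b (fun q => c q t) p *
    ‖velocity a b (fun q => c q t) p‖) hab.le
    (hc.continuousOn_curvature.mul hc.continuousOn_velocity.norm)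

theorem curveLength_pos (hc : IsSolution f a b c₀ T c) (hab : a < b) {t : ℝ}
    (ht : t ∈ timeInterval T) : 0 < curveLength a b (fun p => c p t) :=
  _root_.curveLength_pos hab (hc.contDiffOn_space t ht) fun p hp => hc.regular p hp t ht

theorem continuousOn_averageCurvature (hc : IsSolution f a b c₀ T c) (hab : a < b) :
    ContinuousOn (fun t => averageCurvature a b (fun p => c p t)) (timeInterval T) :=
  (hc.continuousOn_totalCurvature hab).div (hc.continuousOn_curveLength hab)
    fun _ ht => (hc.curveLength_pos hab ht).ne'

/-- Mixed derivatives commute, and the tangential part of ∂_p ∂_t c comes from differentiating ⟨∂_t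
c, ∂_p c⟩ = 0 in p, which avoids differentiating the normal or the curvature. -/
theorem hasDerivAt_norm_velocity (hc : IsSolution f a b c₀ T c) {p t : ℝ}
    (hp : p ∈ Set.Ioo a b) (ht : t ∈ timeInterval T ∩ Set.Ioi 0) :
    HasDerivAt (fun u => ‖velocity a b (fun q => c q u) p‖)
      (-((curvature a b (fun q => c q t) p - averageCurvature a b (fun q => c q t)) *
        (curvature a b (fun q => c q t) p * ‖velocity a b (fun q => c q t) p‖))) t := by
  set F : ℝ × ℝ → ℂ := fun z => c z.1 z.2 with hF
  set U : Set (ℝ × ℝ) := Set.Ioo a b ×ˢ (timeInterval T ∩ Set.Ioi 0) with hU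
  have hUo : IsOpen U := isOpen_Ioo.prod (isOpen_timeInterval_inter_Ioi T)
  have hFU : ∀ z ∈ U, ContDiffAt ℝ ∞ F z := fun z hz =>
    (hc.smooth.mono (Set.prod_mono_left Set.Ioo_subset_Icc_self)).contDiffAt (hUo.mem_nhds hz)
  have hFd : ∀ z ∈ U, HasFDerivAt F (fderiv ℝ F z) z := fun z hz =>
    ((hFU z hz).differentiableAt (by simp)).hasFDerivAt
  have hX : ∀ z ∈ U, HasDerivAt (fun q => c q z.2) (fderiv ℝ F z (1, 0)) z.1 := by
    intro z hz
    have h1 : HasDerivAt (fun q : ℝ => (q, z.2)) ((1 : ℝ), (0 : ℝ)) z.1 :=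
      (hasDerivAt_id _).prodMk (hasDerivAt_const _ _)
    exact (hFd z hz).comp_hasDerivAt z.1 h1
  have hY : ∀ z ∈ U, HasDerivAt (fun u => c z.1 u) (fderiv ℝ F z (0, 1)) z.2 := by
    intro z hz
    have h1 : HasDerivAt (fun u : ℝ => (z.1, u)) ((0 : ℝ), (1 : ℝ)) z.2 :=
      (hasDerivAt_const _ _).prodMk (hasDerivAt_id _)
    exact (hFd z hz).comp_hasDerivAt z.2 h1
  have hvel : ∀ z ∈ U, velocity a b (fun q => c q z.2) z.1 = fderiv ℝ F z (1, 0) := by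
    intro z hz
    rw [velocity, derivWithin_of_mem_nhds (Icc_mem_nhds hz.1.1 hz.1.2)]
    exact (hX z hz).deriv
  have hflow : ∀ z ∈ U, fderiv ℝ F z (0, 1) = (curvature a b (fun q => c q z.2) z.1 -
      averageCurvature a b (fun q => c q z.2)) • unitNormal a b (fun q => c q z.2) z.1 := by
    intro z hz
    rw [← hc.flow z.1 (Set.Ioo_subset_Icc_self hz.1) z.2 hz.2.1, derivWithin_of_mem_nhds]
    · exact (hY z hz).deriv.symm
    · exact Filter.mem_of_superset
        ((isOpen_timeInterval_inter_Ioi T).mem_nhds hz.2) Set.inter_subset_left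
  have hz : (p, t) ∈ U := ⟨hp, ht⟩
  have hD : HasFDerivAt (fderiv ℝ F) (fderiv ℝ (fderiv ℝ F) (p, t)) (p, t) :=
    (((hFU _ hz).fderiv_right (m := 1)
      (by rw [one_add_one_eq_two]; exact ENat.LEInfty.out)).differentiableAt (by simp)).hasFDerivAt
  set D := fderiv ℝ (fderiv ℝ F) (p, t) with hDdef
  have hsymm : D (0, 1) (1, 0) = D (1, 0) (0, 1) :=
    (hFU _ hz).isSymmSndFDerivAt (by simpa using ENat.LEInfty.out) _ _
  have hpath1 : HasDerivAt (fun q : ℝ => (q, t)) ((1 : ℝ), (0 : ℝ)) p :=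
    (hasDerivAt_id _).prodMk (hasDerivAt_const _ _)
  have hpath2 : HasDerivAt (fun u : ℝ => (p, u)) ((0 : ℝ), (1 : ℝ)) t :=
    (hasDerivAt_const _ _).prodMk (hasDerivAt_id _)
  have hev : ∀ v : ℝ × ℝ, HasFDerivAt (fun z => fderiv ℝ F z v)
      ((ContinuousLinearMap.apply ℝ ℂ v).comp D) (p, t) := fun v =>
    (ContinuousLinearMap.apply ℝ ℂ v).hasFDerivAt.comp (p, t) hD
  have hXp : HasDerivAt (fun q => fderiv ℝ F (q, t) (1, 0)) (D (1, 0) (1, 0)) p := by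
    have h := (hev (1, 0)).comp_hasDerivAt p hpath1
    exact h
  have hYp : HasDerivAt (fun q => fderiv ℝ F (q, t) (0, 1)) (D (1, 0) (0, 1)) p := by
    have h := (hev (0, 1)).comp_hasDerivAt p hpath1
    exact h
  have hXt : HasDerivAt (fun u => fderiv ℝ F (p, u) (1, 0)) (D (0, 1) (1, 0)) t := by
    have h := (hev (1, 0)).comp_hasDerivAt t hpath2
    exact h
  have hnear1 : ∀ᶠ q in nhds p, (q, t) ∈ U :=
    hpath1.continuousAt.eventually_mem (hUo.mem_nhds hz)
  have hnear2 : ∀ᶠ u in nhds t, (p, u) ∈ U :=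
    hpath2.continuousAt.eventually_mem (hUo.mem_nhds hz)
  have hacc : acceleration a b (fun q => c q t) p = D (1, 0) (1, 0) := by
    rw [acceleration, derivWithin_of_mem_nhds (Icc_mem_nhds hp.1 hp.2)]
    apply HasDerivAt.deriv
    apply hXp.congr_of_eventuallyEq
    filter_upwards [hnear1] with q hq using hvel _ hq
  have horth : inner ℝ (D (1, 0) (0, 1)) (fderiv ℝ F (p, t) (1, 0)) +
      inner ℝ (fderiv ℝ F (p, t) (0, 1)) (D (1, 0) (1, 0)) = 0 := by
    have h1 := hYp.inner ℝ hXp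
    have h2 : HasDerivAt (fun q => inner ℝ (fderiv ℝ F (q, t) (0, 1))
        (fderiv ℝ F (q, t) (1, 0))) 0 p := by
      apply (hasDerivAt_const p (0 : ℝ)).congr_of_eventuallyEq
      filter_upwards [hnear1] with q hq
      rw [hflow _ hq, ← hvel _ hq, real_inner_smul_left, inner_unitNormal_velocity, mul_zero]
    have h3 := h1.unique h2
    linarith
  have hreg := hc.regular p (Set.Ioo_subset_Icc_self hp) t ht.1
  have hvz := hvel _ hz
  simp only at hvz
  have hn : ‖fderiv ℝ F (p, t) (1, 0)‖ ≠ 0 := by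
    rw [← hvz]; exact norm_ne_zero_iff.2 hreg
  have hnorm : HasDerivAt (fun u => ‖fderiv ℝ F (p, u) (1, 0)‖)
      (inner ℝ (fderiv ℝ F (p, t) (1, 0)) (D (0, 1) (1, 0)) /
        ‖fderiv ℝ F (p, t) (1, 0)‖) t := by
    have h1 := hXt.norm_sq.sqrt (pow_ne_zero 2 hn)
    simp only [Real.sqrt_sq (norm_nonneg _)] at h1
    convert! h1 using 1
    field_simp
  have hfin := hnorm.congr_of_eventuallyEq (f₁ := fun u => ‖velocity a b (fun q => c q u) p‖) (by
    filter_upwards [hnear2] with u hu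
    rw [hvel _ hu])
  convert! hfin using 1
  have hfl := hflow _ hz
  simp only at hfl
  rw [hsymm, real_inner_comm, eq_neg_of_add_eq_zero_left horth, hfl, ← hacc,
    real_inner_smul_left, inner_unitNormal_acceleration hreg, ← hvz]
  have := norm_ne_zero_iff.2 hreg
  field_simp

theorem hasDerivAt_curveLength (hc : IsSolution f a b c₀ T c) (hab : a < b) {t : ℝ}
    (ht : t ∈ timeInterval T ∩ Set.Ioi 0) :
    HasDerivAt (fun u => curveLength a b (fun p => c p u))
      (∫ p in a..b, -((curvature a b (fun q => c q t) p - averageCurvature a b (fun q => c q t)) *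
        (curvature a b (fun q => c q t) p * ‖velocity a b (fun q => c q t) p‖))) t := by
  obtain ⟨ε, hε, hball⟩ := Metric.isOpen_iff.1 (isOpen_timeInterval_inter_Ioi T) t ht
  set K : Set ℝ := Metric.closedBall t (ε / 2) with hK
  have hKT : K ⊆ timeInterval T ∩ Set.Ioi 0 :=
    (Metric.closedBall_subset_ball (by linarith)).trans hball
  have hcont : ContinuousOn (fun z : ℝ × ℝ =>
      -((curvature a b (fun q => c q z.2) z.1 - averageCurvature a b (fun q => c q z.2)) *
        (curvature a b (fun q => c q z.2) z.1 * ‖velocity a b (fun q => c q z.2) z.1‖)))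
      (Set.Icc a b ×ˢ timeInterval T) := by
    have hκ := hc.continuousOn_curvature
    have hav : ContinuousOn (fun z : ℝ × ℝ => averageCurvature a b (fun q => c q z.2))
        (Set.Icc a b ×ˢ timeInterval T) :=
      (hc.continuousOn_averageCurvature hab).comp continuousOn_snd fun z hz => hz.2
    exact ((hκ.sub hav).mul (hκ.mul hc.continuousOn_velocity.norm)).neg
  obtain ⟨M, hM⟩ := (isCompact_Icc.prod (isCompact_closedBall t (ε / 2))).exists_bound_of_continuousOn
    (hcont.mono (Set.prod_mono_right (hKT.trans Set.inter_subset_left)))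
  have hslice : ∀ u ∈ timeInterval T,
      ContinuousOn (fun p => ‖velocity a b (fun q => c q u) p‖) (Set.Icc a b) := fun u hu =>
    (contDiffOn_velocity hab (hc.contDiffOn_space u hu)).continuousOn.norm
  have hint : ∀ u ∈ timeInterval T, IntervalIntegrable
      (fun p => ‖velocity a b (fun q => c q u) p‖) MeasureTheory.volume a b := by
    intro u hu
    apply ContinuousOn.intervalIntegrable
    rw [Set.uIcc_of_le hab.le]
    exact hslice u hu
  have hslice' : ContinuousOn (fun p =>
      -((curvature a b (fun q => c q t) p - averageCurvature a b (fun q => c q t)) *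
        (curvature a b (fun q => c q t) p * ‖velocity a b (fun q => c q t) p‖))) (Set.Icc a b) :=
    hcont.comp (f := fun p => (p, t)) (by fun_prop) fun p hp => ⟨hp, ht.1⟩
  refine (intervalIntegral.hasDerivAt_integral_of_dominated_loc_of_deriv_le
    (F := fun u p => ‖velocity a b (fun q => c q u) p‖)
    (F' := fun u p => -((curvature a b (fun q => c q u) p - averageCurvature a b (fun q => c q u)) *
        (curvature a b (fun q => c q u) p * ‖velocity a b (fun q => c q u) p‖)))
    (s := K) (bound := fun _ => M) (Metric.closedBall_mem_nhds t (by linarith)) ?_ (hint t ht.1) ?_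
    ?_ intervalIntegrable_const ?_).2
  · filter_upwards [(isOpen_timeInterval_inter_Ioi T).mem_nhds ht] with u hu
    exact (hint u hu.1).aestronglyMeasurable_restrict_uIoc
  · rw [Set.uIoc_of_le hab.le]
    exact (hslice'.mono Set.Ioc_subset_Icc_self).aestronglyMeasurable measurableSet_Ioc
  · refine Filter.Eventually.of_forall fun p hp u hu => ?_
    rw [Set.uIoc_of_le hab.le] at hp
    exact hM (p, u) ⟨Set.Ioc_subset_Icc_self hp, hu⟩
  · have hb : ∀ᵐ p : ℝ, p ≠ b := by simp [MeasureTheory.ae_iff]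
    filter_upwards [hb] with p hpb hp u hu
    rw [Set.uIoc_of_le hab.le] at hp
    exact hc.hasDerivAt_norm_velocity ⟨hp.1, lt_of_le_of_ne hp.2 hpb⟩ (hKT hu)

/-- Write κ = (κ - κ̄) + κ̄ in ∫ (κ - κ̄) κ ds: the second term integrates to zero and the first is
a square. -/
theorem deriv_curveLength_nonpos (hc : IsSolution f a b c₀ T c) (hab : a < b) {t : ℝ}
    (ht : t ∈ timeInterval T ∩ Set.Ioi 0) :
    deriv (fun u => curveLength a b (fun p => c p u)) t ≤ 0 := by
  rw [(hc.hasDerivAt_curveLength hab ht).deriv]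
  set κ := curvature a b (fun q => c q t) with hκ
  set m := averageCurvature a b (fun q => c q t) with hm
  set w := fun p => ‖velocity a b (fun q => c q t) p‖ with hw
  have hwc : ContinuousOn w (Set.uIcc a b) := by
    rw [Set.uIcc_of_le hab.le]
    exact (contDiffOn_velocity hab (hc.contDiffOn_space t ht.1)).continuousOn.norm
  have hκc : ContinuousOn κ (Set.uIcc a b) := by
    rw [Set.uIcc_of_le hab.le]
    exact hc.continuousOn_curvature.comp (f := fun p => (p, t)) (by fun_prop)
      fun p hp => ⟨hp, ht.1⟩
  have hL : ∫ p in a..b, w p = curveLength a b (fun q => c q t) := rfl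
  have hA : ∫ p in a..b, κ p * w p = totalCurvature a b (fun q => c q t) := rfl
  have hmL : m * curveLength a b (fun q => c q t) = totalCurvature a b (fun q => c q t) :=
    div_mul_cancel₀ _ (hc.curveLength_pos hab ht.1).ne'
  have hzero : ∫ p in a..b, m * (κ p * w p - m * w p) = 0 := by
    have h1 : IntervalIntegrable (fun p => κ p * w p) MeasureTheory.volume a b :=
      (hκc.mul hwc).intervalIntegrable
    have h2 : IntervalIntegrable (fun p => m * w p) MeasureTheory.volume a b :=
      (continuousOn_const.mul hwc).intervalIntegrable
    rw [intervalIntegral.integral_const_mul, intervalIntegral.integral_sub h1 h2,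
      intervalIntegral.integral_const_mul, hL, hA, hmL, sub_self, mul_zero]
  have hsplit : ∫ p in a..b, -((κ p - m) * (κ p * w p)) =
      -(∫ p in a..b, (κ p - m) ^ 2 * w p) - ∫ p in a..b, m * (κ p * w p - m * w p) := by
    rw [← intervalIntegral.integral_neg, ← intervalIntegral.integral_sub]
    · congr 1; funext p; ring
    · exact ((((hκc.sub continuousOn_const).pow 2).mul hwc).neg).intervalIntegrable
    · exact (continuousOn_const.mul ((hκc.mul hwc).sub
        (continuousOn_const.mul hwc))).intervalIntegrable
  change ∫ p in a..b, -((κ p - m) * (κ p * w p)) ≤ 0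
  rw [hsplit, hzero, sub_zero, neg_nonpos]
  exact intervalIntegral.integral_nonneg hab.le fun p _ =>
    mul_nonneg (sq_nonneg _) (norm_nonneg _)

theorem antitoneOn_curveLength (hc : IsSolution f a b c₀ T c) (hab : a < b) :
    AntitoneOn (fun t => curveLength a b (fun p => c p t)) (timeInterval T) := by
  have hint : interior (timeInterval T) ⊆ timeInterval T ∩ Set.Ioi 0 := by
    intro t ht
    refine ⟨interior_subset ht, ?_⟩
    have h : interior (timeInterval T) ⊆ interior (Set.Ici 0) :=
      interior_mono fun t ht => ht.1
    rw [interior_Ici] at h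
    exact h ht
  exact antitoneOn_of_deriv_nonpos (ordConnected_timeInterval T).convex
    (hc.continuousOn_curveLength hab)
    (fun t ht => (hc.hasDerivAt_curveLength hab (hint ht)).differentiableAt.differentiableWithinAt)
    fun t ht => hc.deriv_curveLength_nonpos hab (hint ht)

/-- The total curvature of a solution that is too short to connect points with opposite tangents
never equals `2π`. -/
theorem totalCurvature_ne_two_pi {ℓ : ℝ} (hf : IsSupportCurve f ℓ) (hc : IsSolution f a b c₀ T c)
    (hab : a < b) {t : ℝ} (ht : t ∈ timeInterval T)
    (hlength : curveLength a b (fun p => c p t) < oppositeTangentDist f) :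
    totalCurvature a b (fun p => c p t) ≠ 2 * Real.pi := by
  intro htotal
  have ha := Set.left_mem_Icc.2 hab.le
  have hb := Set.right_mem_Icc.2 hab.le
  have hγ := hc.contDiffOn_space t ht
  have hreg : ∀ p ∈ Set.Icc a b, velocity a b (fun q => c q t) p ≠ 0 :=
    fun p hp => hc.regular p hp t ht
  obtain ⟨φ, hφ, hexp⟩ := exists_continuousOn_log_velocity hab hγ hreg
  rw [totalCurvature_eq hab hγ hreg hφ hexp] at htotal
  obtain ⟨s, hs, hds⟩ := (hc.left t ht).exists_deriv_eq_I_mul hf (norm_unitTangent (hreg a ha))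
  obtain ⟨u, hu, hdu⟩ := (hc.right t ht).exists_deriv_eq_neg_I_mul hf
    (norm_unitTangent (hreg b hb))
  have hτ : unitTangent a b (fun q => c q t) b = unitTangent a b (fun q => c q t) a := by
    rw [unitTangent_eq_exp (hexp a ha), unitTangent_eq_exp (hexp b hb),
      eq_add_of_sub_eq' htotal,
      ← Complex.exp_periodic (((φ a).im : ℂ) * Complex.I)]
    congr 1
    push_cast
    ring
  have h1 := oppositeTangentDist_le f (s := u) (u := s) (by rw [hdu, hds, hτ])
  rw [hs, hu] at h1
  exact absurd (h1.trans (norm_sub_le_curveLength hab hγ le_rfl hab.le le_rfl)) (not_le.2 hlength)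

end IsSolution

/-! ### The continuity argument in time. -/

theorem mainTheorem7 (f : ℝ → ℂ) (ℓ : ℝ) (hf : IsSupportCurve f ℓ)
    (a b : ℝ) (c₀ : ℝ → ℂ) (hc₀ : IsInitialCurve f a b c₀)
    (T : EReal) (hT : 0 < T) (c : ℝ → ℝ → ℂ) (hc : IsSolution f a b c₀ T c)
    (hcurv : ∀ p ∈ Set.Icc a b, 0 < curvature a b c₀ p)
    (hsimple : Set.InjOn c₀ (Set.Icc a b))
    (houter : ∀ p ∈ Set.Ioo a b, c₀ p ∈ outerDomain (Set.range f))
    (hlength : curveLength a b c₀ < oppositeTangentDist f) :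
    ∀ t ∈ timeInterval T, totalCurvature a b (fun p => c p t) < 2 * Real.pi := by
  have hab := hc₀.lt
  have h0 : (0 : ℝ) ∈ timeInterval T := ⟨le_rfl, by simpa using hT⟩
  have hvel : Set.EqOn (velocity a b (fun p => c p 0)) (velocity a b c₀) (Set.Icc a b) :=
    fun p hp => derivWithin_congr hc.initial (hc.initial p hp)
  have hacc : Set.EqOn (acceleration a b (fun p => c p 0)) (acceleration a b c₀) (Set.Icc a b) :=
    fun p hp => derivWithin_congr hvel (hvel hp)
  have hlen0 : curveLength a b (fun p => c p 0) = curveLength a b c₀ := by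
    apply intervalIntegral.integral_congr
    intro p hp
    rw [Set.uIcc_of_le hab.le] at hp
    simp only [hvel hp]
  have htot0 : totalCurvature a b (fun p => c p 0) = totalCurvature a b c₀ := by
    apply intervalIntegral.integral_congr
    intro p hp
    rw [Set.uIcc_of_le hab.le] at hp
    simp only
    rw [curvature_mul_norm_velocity, curvature_mul_norm_velocity, hvel hp, hacc hp]
  have hlt0 : totalCurvature a b (fun p => c p 0) < 2 * Real.pi := by
    rw [htot0]
    exact totalCurvature_lt_two_pi hf hab (hc₀.smooth.of_le ENat.LEInfty.out) hc₀.regular hsimple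
      hc₀.left hc₀.right houter hlength
  intro t ht
  by_contra! hge
  have hsub : Set.Icc 0 t ⊆ timeInterval T := (ordConnected_timeInterval T).out h0 ht
  -- A total curvature of at least 2π at time `t` would force the excluded value 2π at some earlier
  -- time or at `t` itself.
  obtain ⟨u, hu, hue⟩ := intermediate_value_Icc ht.1
    ((hc.continuousOn_totalCurvature hab).mono hsub) ⟨hlt0.le, hge⟩
  refine hc.totalCurvature_ne_two_pi hf hab (hsub hu) ?_ hue
  exact (hc.antitoneOn_curveLength hab h0 (hsub hu) hu.1).trans_lt
    (by simpa only [hlen0] using hlength)
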